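/- Let $n>m>0$ be integers and $d:=n-m$. Let $A\in\mathbb{Z}^{d\times n}$ be an integer matrix with columns $a_1,\dots,a_n$ that span $\mathbb{Z}^d$ as a lattice, and assume that $A$ is pointed, i.e. there is $h\in\mathbb{R}^d$ with $h\cdot a_i>0$ for all $i$. Let $B\in\mathbb{Z}^{n\times m}$, with rows $B_1,\dots,B_n$, be a matrix whose columns span $\ker_{\mathbb{Z}}(A)=\{w\in\mathbb{Z}^n : Aw=0\}$ as a lattice. Let $\beta\in\mathbb{C}^d$, and let $\kappa\in\mathbb{C}^n$ satisfy $A\kappa=\beta$. Let $D_X$ be the Laurent Weyl algebra $\mathbb{C}[x_1^{\pm1},\dots,x_n^{\pm1}]\langle\partial_{x_1},\dots,\partial_{x_n}\rangle$ of linear partial differential operators with Laurent polynomial coefficients on $X=(\mathbb{C}^*)^n$, and let $D_Z$ be the Laurent Weyl algebra in the variables $z_1,\dots,z_m$. Put $\theta_i:=x_i\partial_{x_i}$, $\eta_j:=z_j\partial_{z_j}$, $\eta:=(\eta_1,\dots,\eta_m)$. The torus $T=(\mathbb{C}^*)^d$ acts on $D_X$ by algebra automorphisms, $t\diamond x_i=t^{a_i}x_i$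 and $t\diamond\partial_{x_i}=t^{-a_i}\partial_{x_i}$; let $[D_X]^T$ be the subalgebra of invariants. Let $E_k:=\sum_{j=1}^n a_{kj}\theta_j\in[D_X]^T$, $1\le k\le d$, be the Euler operators of $A$. Then $[D_X]^T$ is spanned over $\mathbb{C}$ by the monomials $x^{Bv}\theta^u$ with $v\in\mathbb{Z}^m$ and $u\in\mathbb{N}^n$, and the rule $$\delta_{B,\kappa}(x^{Bv}\theta^u):=z^v\prod_{i=1}^n(B_i\cdot\eta+\kappa_i)^{u_i}\qquad(v\in\mathbb{Z}^m,\ u\in\mathbb{N}^n)$$ extends linearly to a well-defined surjective homomorphism of $\mathbb{C}$-algebras $\delta_{B,\kappa}\colon[D_X]^T\to D_Z$, whose kernel is the two-sided ideal of $[D_X]^T$ generated by $E_1-\beta_1,\dots,E_d-\beta_d$. -/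

import Mathlib

/-- The generators of the Laurent Weyl algebra in `n` variables:
the coordinates `x_i`, their inverses, and the derivations `∂_i`. -/
inductive LaurentWeylGen (n : ℕ) : Type
  | x (i : Fin n)
  | xInv (i : Fin n)
  | d (i : Fin n)

namespace LaurentWeylGen

/-- The generators as elements of the free associative `ℂ`-algebra. -/
def free {n : ℕ} (g : LaurentWeylGen n) : FreeAlgebra ℂ (LaurentWeylGen n) :=
  FreeAlgebra.ι ℂ g

end LaurentWeylGen

open LaurentWeylGen in
/-- The defining relations of the Laurent Weyl algebra: those of the Weyl algebra
(`x_i x_j = x_j x_i`, `∂_i ∂_j = ∂_j ∂_i`, `∂_i x_j = x_j ∂_i + δ_{ij}`), and the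
relations that make `xInv i` the inverse of `x_i`. -/
inductive LaurentWeylRel (n : ℕ) :
    FreeAlgebra ℂ (LaurentWeylGen n) → FreeAlgebra ℂ (LaurentWeylGen n) → Prop
  | x_comm (i j : Fin n) :
      LaurentWeylRel n ((x i).free * (x j).free) ((x j).free * (x i).free)
  | d_comm (i j : Fin n) :
      LaurentWeylRel n ((d i).free * (d j).free) ((d j).free * (d i).free)
  | d_x (i j : Fin n) :
      LaurentWeylRel n ((d i).free * (x j).free)
        ((x j).free * (d i).free + if i = j then 1 else 0)
  | x_xInv (i : Fin n) : LaurentWeylRel n ((x i).free * (xInv i).free) 1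
  | xInv_x (i : Fin n) : LaurentWeylRel n ((xInv i).free * (x i).free) 1

/-- The Laurent Weyl algebra in `n` variables, that is, the ring of linear partial differential
operators on the torus `(ℂ^*)^n`: the Weyl algebra with its `n` coordinates inverted. -/
def LaurentWeyl (n : ℕ) : Type := RingQuot (LaurentWeylRel n)

namespace LaurentWeyl

noncomputable instance (n : ℕ) : Ring (LaurentWeyl n) :=
  inferInstanceAs (Ring (RingQuot (LaurentWeylRel n)))

noncomputable instance (n : ℕ) : Algebra ℂ (LaurentWeyl n) :=
  inferInstanceAs (Algebra ℂ (RingQuot (LaurentWeylRel n)))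

/-- The projection from the free algebra. -/
noncomputable def mk (n : ℕ) : FreeAlgebra ℂ (LaurentWeylGen n) →ₐ[ℂ] LaurentWeyl n :=
  RingQuot.mkAlgHom ℂ (LaurentWeylRel n)

theorem mk_rel {n : ℕ} {a b : FreeAlgebra ℂ (LaurentWeylGen n)} (h : LaurentWeylRel n a b) :
    mk n a = mk n b :=
  RingQuot.mkAlgHom_rel ℂ h

/-- The class of a generator. -/
noncomputable def gen {n : ℕ} (g : LaurentWeylGen n) : LaurentWeyl n := mk n g.free

/-- The algebra homomorphism with prescribed values `f` on the generators. -/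
noncomputable def lift {n : ℕ} {R : Type*} [Ring R] [Algebra ℂ R] (f : LaurentWeylGen n → R)
    (hf : ∀ ⦃a b⦄, LaurentWeylRel n a b → FreeAlgebra.lift ℂ f a = FreeAlgebra.lift ℂ f b) :
    LaurentWeyl n →ₐ[ℂ] R :=
  RingQuot.liftAlgHom ℂ ⟨FreeAlgebra.lift ℂ f, hf⟩

theorem lift_gen {n : ℕ} {R : Type*} [Ring R] [Algebra ℂ R] (f : LaurentWeylGen n → R)
    (hf : ∀ ⦃a b⦄, LaurentWeylRel n a b → FreeAlgebra.lift ℂ f a = FreeAlgebra.lift ℂ f b)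
    (g : LaurentWeylGen n) : lift f hf (gen g) = f g :=
  (RingQuot.liftAlgHom_mkAlgHom_apply ℂ (FreeAlgebra.lift ℂ f) hf g.free).trans
    (FreeAlgebra.lift_ι_apply f g)

/-- The derivation `∂_i`. -/
noncomputable def d {n : ℕ} (i : Fin n) : LaurentWeyl n := gen (.d i)

theorem gen_x_mul_xInv {n : ℕ} (i : Fin n) :
    (gen (.x i) * gen (.xInv i) : LaurentWeyl n) = 1 := by
  simpa [gen] using mk_rel (LaurentWeylRel.x_xInv i)

theorem gen_xInv_mul_x {n : ℕ} (i : Fin n) :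
    (gen (.xInv i) * gen (.x i) : LaurentWeyl n) = 1 := by
  simpa [gen] using mk_rel (LaurentWeylRel.xInv_x i)

/-- The coordinate `x_i`, an invertible element. -/
noncomputable def x {n : ℕ} (i : Fin n) : (LaurentWeyl n)ˣ where
  val := gen (.x i)
  inv := gen (.xInv i)
  val_inv := gen_x_mul_xInv i
  inv_val := gen_xInv_mul_x i

/-- The operator `θ_i = x_i ∂_i`. -/
noncomputable def theta {n : ℕ} (i : Fin n) : LaurentWeyl n := (x i : LaurentWeyl n) * d i

/-- The product `f_1 f_2 ⋯ f_n`. It is used for commuting factors only. -/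
def prodFin {R : Type*} [Monoid R] {n : ℕ} (f : Fin n → R) : R := (List.ofFn f).prod

/-- The Laurent monomial `x^w = x_1^{w_1} ⋯ x_n^{w_n}` with `w ∈ ℤ^n`. -/
noncomputable def xPow {n : ℕ} (w : Fin n → ℤ) : LaurentWeyl n :=
  prodFin fun i => ((x i ^ w i : (LaurentWeyl n)ˣ) : LaurentWeyl n)

/-- The monomial `θ^u = θ_1^{u_1} ⋯ θ_n^{u_n}` with `u ∈ ℕ^n`. -/
noncomputable def thetaPow {n : ℕ} (u : Fin n → ℕ) : LaurentWeyl n :=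
  prodFin fun i => theta i ^ u i

/-! ### Rescaling the variables, and the torus action -/

/-- Images of the generators under rescaling by `c`: `x_i ↦ c_i x_i`, `∂_i ↦ c_i⁻¹ ∂_i`. -/
noncomputable def scaleGen {n : ℕ} (c : Fin n → ℂˣ) : LaurentWeylGen n → LaurentWeyl n
  | .x i => (c i : ℂ) • gen (.x i)
  | .xInv i => (((c i)⁻¹ : ℂˣ) : ℂ) • gen (.xInv i)
  | .d i => (((c i)⁻¹ : ℂˣ) : ℂ) • gen (.d i)

theorem scaleGen_rel {n : ℕ} (c : Fin n → ℂˣ) ⦃a b : FreeAlgebra ℂ (LaurentWeylGen n)⦄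
    (h : LaurentWeylRel n a b) :
    FreeAlgebra.lift ℂ (scaleGen c) a = FreeAlgebra.lift ℂ (scaleGen c) b := by
  have key := mk_rel h
  cases h with
  | x_comm i j =>
    simp only [map_mul] at key
    change gen _ * gen _ = gen _ * gen _ at key
    simp [LaurentWeylGen.free, scaleGen, key, smul_smul, mul_comm]
  | d_comm i j =>
    simp only [map_mul] at key
    change gen _ * gen _ = gen _ * gen _ at key
    simp [LaurentWeylGen.free, scaleGen, key, smul_smul, mul_comm]
  | d_x i j =>
    simp only [map_mul, map_add] at key
    change gen _ * gen _ = gen _ * gen _ + _ at key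
    by_cases hij : i = j
    · subst hij
      simp only [if_true, map_one] at key
      simp [LaurentWeylGen.free, scaleGen, key, smul_smul]
    · simp only [if_neg hij, map_zero] at key
      simp [LaurentWeylGen.free, scaleGen, key, smul_smul, mul_comm, hij]
  | x_xInv i => simp [LaurentWeylGen.free, scaleGen, gen_x_mul_xInv, smul_smul]
  | xInv_x i => simp [LaurentWeylGen.free, scaleGen, gen_xInv_mul_x, smul_smul]

/-- The algebra endomorphism `x_i ↦ c_i x_i`, `∂_i ↦ c_i⁻¹ ∂_i`. -/
noncomputable def scale {n : ℕ} (c : Fin n → ℂˣ) : LaurentWeyl n →ₐ[ℂ] LaurentWeyl n :=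
  lift (scaleGen c) (scaleGen_rel c)

theorem scale_gen {n : ℕ} (c : Fin n → ℂˣ) (g : LaurentWeylGen n) :
    scale c (gen g) = scaleGen c g :=
  lift_gen _ _ g

/-- The character `t^a = t_1^{a_1} ⋯ t_d^{a_d}` of the torus `T = (ℂ^*)^d`. -/
def character {d : ℕ} (t : Fin d → ℂˣ) (a : Fin d → ℤ) : ℂˣ := ∏ k, t k ^ a k

/-- The action of `t ∈ T = (ℂ^*)^d` given by the matrix `A` with columns `a_1, …, a_n`:
`t ⋄ x_i = t^{a_i} x_i` and `t ⋄ ∂_i = t^{-a_i} ∂_i`. -/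
noncomputable def torusAct {d n : ℕ} (A : Matrix (Fin d) (Fin n) ℤ) (t : Fin d → ℂˣ) :
    LaurentWeyl n →ₐ[ℂ] LaurentWeyl n :=
  scale fun i => character t (A.col i)

/-- The algebra of torus invariants. -/
noncomputable def invariants {d n : ℕ} (A : Matrix (Fin d) (Fin n) ℤ) :
    Subalgebra ℂ (LaurentWeyl n) where
  carrier := {P | ∀ t : Fin d → ℂˣ, torusAct A t P = P}
  mul_mem' {P Q} hP hQ t := by rw [map_mul, hP t, hQ t]
  add_mem' {P Q} hP hQ t := by rw [map_add, hP t, hQ t]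
  algebraMap_mem' r t := AlgHom.commutes _ r

/-! ### Invariant elements -/

theorem scale_theta {n : ℕ} (c : Fin n → ℂˣ) (i : Fin n) : scale c (theta i) = theta i := by
  simp [theta, x, d, scale_gen, scaleGen, smul_smul]

theorem theta_mem_invariants {d n : ℕ} (A : Matrix (Fin d) (Fin n) ℤ) (i : Fin n) :
    theta i ∈ invariants A := fun _ => scale_theta _ i

theorem prodFin_mem {d n k : ℕ} (A : Matrix (Fin d) (Fin n) ℤ) (f : Fin k → LaurentWeyl n)
    (hf : ∀ i, f i ∈ invariants A) : prodFin f ∈ invariants A :=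
  list_prod_mem fun y hy => by
    obtain ⟨i, rfl⟩ := (List.mem_ofFn' f y).1 hy
    exact hf i

theorem thetaPow_mem_invariants {d n : ℕ} (A : Matrix (Fin d) (Fin n) ℤ) (u : Fin n → ℕ) :
    thetaPow u ∈ invariants A :=
  prodFin_mem A _ fun i => pow_mem (theta_mem_invariants A i) (u i)

theorem map_scale_x {n : ℕ} (c : Fin n → ℂˣ) (i : Fin n) :
    Units.map (scale c : LaurentWeyl n →* LaurentWeyl n) (x i)
      = Units.map (algebraMap ℂ (LaurentWeyl n) : ℂ →* LaurentWeyl n) (c i) * x i := by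
  ext
  simp [x, scale_gen, scaleGen, Algebra.smul_def]

theorem scale_x_zpow {n : ℕ} (c : Fin n → ℂˣ) (i : Fin n) (k : ℤ) :
    scale c ((x i ^ k : (LaurentWeyl n)ˣ) : LaurentWeyl n)
      = (((c i) ^ k : ℂˣ) : ℂ) • ((x i ^ k : (LaurentWeyl n)ˣ) : LaurentWeyl n) := by
  have h : Commute (Units.map (algebraMap ℂ (LaurentWeyl n) : ℂ →* LaurentWeyl n) (c i)) (x i) := by
    ext
    simpa using Algebra.commutes (c i : ℂ) (x i : LaurentWeyl n)
  have h2 := congrArg (fun y : (LaurentWeyl n)ˣ => y ^ k) (map_scale_x c i)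
  simp only [h.mul_zpow] at h2
  have h3 := congrArg (Units.val) h2
  rw [← map_zpow, ← map_zpow] at h3
  rw [Algebra.smul_def]
  exact h3

theorem scale_xPow {n : ℕ} (c : Fin n → ℂˣ) (w : Fin n → ℤ) :
    scale c (xPow w) = ((∏ i, c i ^ w i : ℂˣ) : ℂ) • xPow w := by
  have aux : ∀ (k : ℕ) (f : Fin k → LaurentWeyl n) (b : Fin k → ℂˣ),
      (∀ i, scale c (f i) = (b i : ℂ) • f i) →
        scale c (prodFin f) = ((∏ i, b i : ℂˣ) : ℂ) • prodFin f := by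
    intro k
    induction k with
    | zero => intro f b _; simp [prodFin]
    | succ k ih =>
      intro f b h
      have h' := ih (fun i => f i.succ) (fun i => b i.succ) fun i => h i.succ
      simp only [prodFin] at h'
      simp [prodFin, List.ofFn_succ, h 0, h', Fin.prod_univ_succ, smul_smul, mul_comm]
  exact aux n _ _ fun i => scale_x_zpow c i (w i)

theorem xPow_mem_invariants {d n : ℕ} (A : Matrix (Fin d) (Fin n) ℤ) (w : Fin n → ℤ)
    (hw : A.mulVec w = 0) : xPow w ∈ invariants A := by
  intro t
  have h : ∏ i, character t (A.col i) ^ w i = 1 := by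
    simp only [character, ← Finset.prod_zpow, ← zpow_mul]
    rw [Finset.prod_comm]
    refine Finset.prod_eq_one fun k _ => ?_
    have hk := congrFun hw k
    simp only [Matrix.mulVec, dotProduct, Pi.zero_apply] at hk
    have hs : ∀ s : Finset (Fin n), ∏ i ∈ s, t k ^ (A k i * w i) = t k ^ ∑ i ∈ s, A k i * w i := by
      intro s
      induction s using Finset.cons_induction with
      | empty => simp
      | cons a s ha ih => rw [Finset.prod_cons, Finset.sum_cons, zpow_add, ih]
    simp only [Matrix.col_apply]
    rw [hs, hk, zpow_zero]
  rw [torusAct, scale_xPow, h]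
  simp

/-- The invariant operator `x^w θ^u`, where `w` lies in the integer kernel of `A`. -/
noncomputable def invMonomial {d n : ℕ} (A : Matrix (Fin d) (Fin n) ℤ) (w : Fin n → ℤ)
    (hw : A.mulVec w = 0) (u : Fin n → ℕ) : invariants A :=
  ⟨xPow w * thetaPow u, mul_mem (xPow_mem_invariants A w hw) (thetaPow_mem_invariants A u)⟩

theorem mulVec_mulVec_eq_zero {d n m : ℕ} {A : Matrix (Fin d) (Fin n) ℤ}
    {B : Matrix (Fin n) (Fin m) ℤ}
    (hB : Submodule.span ℤ (Set.range B.col) = LinearMap.ker A.mulVecLin) (v : Fin m → ℤ) :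
    A.mulVec (B.mulVec v) = 0 := by
  have h : B.mulVec v ∈ Submodule.span ℤ (Set.range B.col) := by
    rw [← Matrix.range_mulVecLin]
    exact ⟨v, rfl⟩
  rw [hB] at h
  exact h

/-- The Euler operators `E_k = ∑_j a_{kj} θ_j` of `A`, as invariant operators. -/
noncomputable def euler {d n : ℕ} (A : Matrix (Fin d) (Fin n) ℤ) (k : Fin d) : invariants A :=
  ∑ j, A k j • (⟨theta j, theta_mem_invariants A j⟩ : invariants A)

/-- The operator `z^v ∏_i (B_i · η + κ_i)^{u_i}`, where `z_1, …, z_m` are the coordinates,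
`η_j = z_j ∂_{z_j}`, and `B_i` is the `i`-th row of `B`. -/
noncomputable def hornMonomial {n m : ℕ} (B : Matrix (Fin n) (Fin m) ℤ) (κ : Fin n → ℂ)
    (v : Fin m → ℤ) (u : Fin n → ℕ) : LaurentWeyl m :=
  xPow v * prodFin fun i =>
    ((∑ j, B i j • (theta j : LaurentWeyl m)) + algebraMap ℂ (LaurentWeyl m) (κ i)) ^ u i

end LaurentWeyl

/-! Let the operators act on formal series `∑ f(s) x^{κ+s}`, that is, on functions `f` on `ℤ^n`:
`x^w` shifts by `w`, and `θ_i` multiplies by `κ_i + s_i`. Every operator is a sum `∑ x^w p_w(θ)`,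
and testing on delta functions shows that the `p_w` are unique and the action is faithful
(`normalForm_surjective`, `normalForm_injective`, `rep_injective`). The torus scales the `w`-term by
`t^{Aw}`, so the invariants are exactly the sums `∑ x^{Bv} p_v(θ)` (`invForm_surjective`).

Such operators act along the coset `κ + Bℤ^m`: pulled back by `v ↦ κ + Bv`, the term `x^{Bv} p(θ)`
becomes `z^v p(Bη + κ)`. So `δ` is restriction to this coset. The operator on the `z` side is unique
(`Intertwines.unique`), and hence `δ` is well defined and multiplicative without any check of
relations among the monomials.

On coefficients, `δ` is the substitution `s = κ + Bη`. Integer matrices with `CA + BD = 1` and `DB =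
1` (`exists_splitting`) give a section of it, hence surjectivity, and show that its kernel is
generated by the forms `a_k · (s - κ)` (`mem_span_eulerPoly`). At `s = θ` these are `E_k - β_k`. -/

namespace LaurentWeyl

/-! ### Products of commuting factors -/

theorem prodFin_succ {R : Type*} [Monoid R] {n : ℕ} (f : Fin (n + 1) → R) :
    prodFin f = f 0 * prodFin fun i => f i.succ := by
  simp [prodFin, List.ofFn_succ]

theorem prodFin_one {R : Type*} [Monoid R] {n : ℕ} : prodFin (fun _ : Fin n => (1 : R)) = 1 := by
  simp [prodFin]

theorem commute_prodFin {R : Type*} [Monoid R] {n : ℕ} {a : R} {f : Fin n → R}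
    (h : ∀ i, Commute a (f i)) : Commute a (prodFin f) := by
  induction n with
  | zero => simp [prodFin]
  | succ n ih => rw [prodFin_succ]; exact (h 0).mul_right (ih fun i => h i.succ)

theorem prodFin_mul {R : Type*} [Monoid R] {n : ℕ} {f g : Fin n → R}
    (h : ∀ i j, Commute (f i) (g j)) :
    prodFin (fun i => f i * g i) = prodFin f * prodFin g := by
  induction n with
  | zero => simp [prodFin]
  | succ n ih =>
    have hc : Commute (prodFin fun i => f i.succ) (g 0) :=
      (commute_prodFin fun i => (h i.succ 0).symm).symm
    rw [prodFin_succ, prodFin_succ f, prodFin_succ g, ih fun i j => h i.succ j.succ]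
    simp only [mul_assoc]
    rw [← mul_assoc (prodFin fun i => f i.succ) (g 0), hc.eq, mul_assoc]

theorem prodFin_eq_single {R : Type*} [Monoid R] {n : ℕ} {f : Fin n → R} (i : Fin n)
    (h : ∀ j, j ≠ i → f j = 1) : prodFin f = f i := by
  induction n with
  | zero => exact i.elim0
  | succ n ih =>
    rw [prodFin_succ]
    refine Fin.cases ?_ (fun i h => ?_) i h
    · intro h
      have : (fun j : Fin n => f j.succ) = fun _ => 1 := funext fun j => h _ (Fin.succ_ne_zero j)
      rw [this, prodFin_one, mul_one]
    · rw [h 0 (Fin.succ_ne_zero i).symm, one_mul]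
      exact ih i fun j hj => h _ fun e => hj (Fin.succ_injective _ e)

theorem map_prodFin {R S F : Type*} [Monoid R] [Monoid S] [FunLike F R S] [MonoidHomClass F R S]
    (φ : F) {n : ℕ} (f : Fin n → R) : φ (prodFin f) = prodFin fun i => φ (f i) := by
  simp only [prodFin, map_list_prod, List.map_ofFn]
  rfl

theorem prodFin_eq_prod {R : Type*} [CommMonoid R] {n : ℕ} (f : Fin n → R) :
    prodFin f = ∏ i, f i := List.prod_ofFn

/-! ### Laurent monomials -/

theorem commute_x {n : ℕ} (i j : Fin n) : Commute (x i) (x j) := by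
  ext
  simpa [gen, x] using mk_rel (LaurentWeylRel.x_comm i j)

theorem xPow_zero {n : ℕ} : xPow (0 : Fin n → ℤ) = 1 := by
  simp [xPow, prodFin_one]

theorem xPow_add {n : ℕ} (w w' : Fin n → ℤ) : xPow (w + w') = xPow w * xPow w' := by
  have h : ∀ i j, Commute ((x i ^ w i : (LaurentWeyl n)ˣ) : LaurentWeyl n)
      ((x j ^ w' j : (LaurentWeyl n)ˣ) : LaurentWeyl n) := fun i j =>
    congrArg Units.val ((commute_x i j).zpow_zpow (w i) (w' j)).eq
  rw [xPow, xPow, xPow, ← prodFin_mul h]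
  simp [zpow_add]

theorem xPow_single {n : ℕ} (i : Fin n) (k : ℤ) :
    xPow (Pi.single i k) = ((x i ^ k : (LaurentWeyl n)ˣ) : LaurentWeyl n) := by
  rw [xPow, prodFin_eq_single i]
  · simp
  · intro j hj
    simp [hj]

theorem intVec_induction {n : ℕ} {p : (Fin n → ℤ) → Prop} (zero : p 0)
    (add : ∀ v w, p v → p w → p (v + w)) (single : ∀ i, p (Pi.single i 1))
    (single_neg : ∀ i, p (Pi.single i (-1))) (w : Fin n → ℤ) : p w := by
  refine Pi.single_induction p w zero add fun i k => ?_
  induction k using Int.induction_on with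
  | zero => simpa using zero
  | succ k ih => rw [Pi.single_add]; exact add _ _ ih (single i)
  | pred k ih => rw [sub_eq_add_neg, Pi.single_add]; exact add _ _ ih (single_neg i)

/-! ### The operators `θ_i` -/

theorem d_mul_x {n : ℕ} (i j : Fin n) :
    (d i * x j : LaurentWeyl n) = x j * d i + if i = j then 1 else 0 := by
  have h := mk_rel (LaurentWeylRel.d_x i j)
  split_ifs at h ⊢ <;> simpa [gen, x, d] using h

theorem commute_d {n : ℕ} (i j : Fin n) : Commute (d i : LaurentWeyl n) (d j) := by
  simpa [gen, d, Commute, SemiconjBy] using mk_rel (LaurentWeylRel.d_comm i j)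

theorem commute_x_val {n : ℕ} (i j : Fin n) :
    Commute (x i : LaurentWeyl n) (x j : LaurentWeyl n) :=
  congrArg Units.val (commute_x i j).eq

theorem theta_mul_x {n : ℕ} (i j : Fin n) :
    (theta i * x j : LaurentWeyl n) = x j * (theta i + if i = j then 1 else 0) := by
  rw [theta, mul_assoc, d_mul_x, mul_add, ← mul_assoc, (commute_x_val i j).eq, mul_assoc, mul_add]
  split_ifs with h
  · rw [h]
  · simp

theorem commute_theta {n : ℕ} (i j : Fin n) : Commute (theta i : LaurentWeyl n) (theta j) := by
  by_cases h : i = j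
  · rw [h]
  have h1 : Commute (theta i : LaurentWeyl n) (x j : LaurentWeyl n) := by
    simpa [h, Commute, SemiconjBy] using theta_mul_x i j
  have h2 : Commute (x i : LaurentWeyl n) (d j) := by
    simpa [Ne.symm h, Commute, SemiconjBy] using (d_mul_x j i).symm
  exact h1.mul_right (h2.mul_left (commute_d i j))

theorem theta_mul_xInv {n : ℕ} (i j : Fin n) :
    theta i * (((x j)⁻¹ : (LaurentWeyl n)ˣ) : LaurentWeyl n)
      = (((x j)⁻¹ : (LaurentWeyl n)ˣ) : LaurentWeyl n) * (theta i - if i = j then 1 else 0) := by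
  rw [Units.eq_inv_mul_iff_mul_eq, ← mul_assoc, Units.mul_inv_eq_iff_eq_mul, sub_mul, theta_mul_x,
    mul_add]
  split_ifs <;> simp

/-- The monomial `x^w` is an eigenvector of `ad θ_i` of weight `w_i`; this is what moves `θ` to the
right of monomials. -/
theorem theta_mul_xPow {n : ℕ} (i : Fin n) (w : Fin n → ℤ) :
    theta i * xPow w = xPow w * (theta i + algebraMap ℂ (LaurentWeyl n) (w i)) := by
  induction w using intVec_induction with
  | zero => simp [xPow_zero]
  | add v w hv hw =>
    rw [xPow_add, ← mul_assoc, hv, mul_assoc, add_mul, hw, Algebra.commutes]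
    simp only [mul_add, mul_assoc, Pi.add_apply, Int.cast_add, map_add]
    abel
  | single j =>
    rw [xPow_single, zpow_one, theta_mul_x]
    by_cases h : i = j
    · simp [h]
    · simp [h]
  | single_neg j =>
    rw [xPow_single, zpow_neg_one, theta_mul_xInv]
    by_cases h : i = j
    · simp [h, sub_eq_add_neg]
    · simp [h]

/-- The substitution of `θ_1, …, θ_n` into polynomials. -/
noncomputable def thetaPoly (n : ℕ) : MvPolynomial (Fin n) ℂ →ₐ[ℂ] LaurentWeyl n :=
  AddMonoidAlgebra.lift ℂ (LaurentWeyl n) (Fin n →₀ ℕ)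
    { toFun := fun u => thetaPow (u.toAdd : Fin n →₀ ℕ)
      map_one' := by simp [thetaPow, prodFin_one]
      map_mul' := fun u v => by
        rw [thetaPow, thetaPow, thetaPow, ← prodFin_mul fun i j => (commute_theta i j).pow_pow _ _]
        simp [pow_add] }

theorem thetaPoly_monomial {n : ℕ} (u : Fin n →₀ ℕ) (c : ℂ) :
    thetaPoly n (MvPolynomial.monomial u c) = c • thetaPow u :=
  AddMonoidAlgebra.lift_single _ _ _

theorem thetaPoly_X {n : ℕ} (i : Fin n) : thetaPoly n (MvPolynomial.X i) = theta i := by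
  rw [MvPolynomial.X, thetaPoly_monomial, one_smul, thetaPow, prodFin_eq_single i]
  · simp
  · intro j hj
    simp [hj.symm]

theorem thetaPoly_prod_pow {n k : ℕ} (q : Fin k → MvPolynomial (Fin n) ℂ) (u : Fin k → ℕ) :
    thetaPoly n (∏ i, q i ^ u i) = prodFin fun i => thetaPoly n (q i) ^ u i := by
  rw [← prodFin_eq_prod, map_prodFin]
  simp

theorem thetaPoly_prod_X_pow {n : ℕ} (u : Fin n → ℕ) :
    thetaPoly n (∏ i, MvPolynomial.X i ^ u i) = thetaPow u := by
  simp only [thetaPoly_prod_pow, thetaPoly_X, thetaPow]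

theorem scale_thetaPoly {n : ℕ} (c : Fin n → ℂˣ) (p : MvPolynomial (Fin n) ℂ) :
    scale c (thetaPoly n p) = thetaPoly n p := by
  have h : (scale c).comp (thetaPoly n) = thetaPoly n :=
    MvPolynomial.algHom_ext fun i => by simp [thetaPoly_X, scale_theta]
  exact DFunLike.congr_fun h p

/-! ### Normal forms -/

/-- The operator `∑_w x^w p_w(θ)`. -/
noncomputable def normalForm (n : ℕ) :
    ((Fin n → ℤ) →₀ MvPolynomial (Fin n) ℂ) →ₗ[ℂ] LaurentWeyl n :=
  Finsupp.lsum ℂ fun w => LinearMap.mulLeft ℂ (xPow w) ∘ₗ (thetaPoly n).toLinearMap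

theorem normalForm_apply {n : ℕ} (F : (Fin n → ℤ) →₀ MvPolynomial (Fin n) ℂ) :
    normalForm n F = F.sum fun w p => xPow w * thetaPoly n p := rfl

theorem normalForm_single {n : ℕ} (w : Fin n → ℤ) (p : MvPolynomial (Fin n) ℂ) :
    normalForm n (Finsupp.single w p) = xPow w * thetaPoly n p := by
  simp [normalForm]

theorem xPow_mul_mem_range_normalForm {n : ℕ} (w : Fin n → ℤ) {P : LaurentWeyl n}
    (hP : P ∈ LinearMap.range (normalForm n)) : xPow w * P ∈ LinearMap.range (normalForm n) := by
  obtain ⟨F, rfl⟩ := hP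
  rw [normalForm_apply, Finsupp.mul_sum]
  refine sum_mem fun v _ => ⟨Finsupp.single (w + v) (F v), ?_⟩
  rw [normalForm_single, xPow_add, mul_assoc]

theorem theta_mul_mem_range_normalForm {n : ℕ} (i : Fin n) {P : LaurentWeyl n}
    (hP : P ∈ LinearMap.range (normalForm n)) : theta i * P ∈ LinearMap.range (normalForm n) := by
  obtain ⟨F, rfl⟩ := hP
  rw [normalForm_apply, Finsupp.mul_sum]
  refine sum_mem fun v _ =>
    ⟨Finsupp.single v ((MvPolynomial.X i + MvPolynomial.C (v i : ℂ)) * F v), ?_⟩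
  change _ = theta i * (xPow v * thetaPoly n (F v))
  rw [normalForm_single, ← mul_assoc, theta_mul_xPow, mul_assoc, map_mul, map_add, thetaPoly_X,
    ← MvPolynomial.algebraMap_eq, AlgHom.commutes]

theorem gen_mul_mem_range_normalForm {n : ℕ} (g : LaurentWeylGen n) {P : LaurentWeyl n}
    (hP : P ∈ LinearMap.range (normalForm n)) : gen g * P ∈ LinearMap.range (normalForm n) := by
  have hinv : ∀ i : Fin n, (gen (.xInv i) : LaurentWeyl n) = xPow (Pi.single i (-1)) := fun i => by
    rw [xPow_single, zpow_neg_one]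
    rfl
  cases g with
  | x i =>
    have h : (gen (.x i) : LaurentWeyl n) = xPow (Pi.single i 1) := by
      rw [xPow_single, zpow_one]
      rfl
    rw [h]
    exact xPow_mul_mem_range_normalForm _ hP
  | xInv i =>
    rw [hinv]
    exact xPow_mul_mem_range_normalForm _ hP
  | d i =>
    have h : (gen (.d i) : LaurentWeyl n) = xPow (Pi.single i (-1)) * theta i := by
      rw [← hinv, theta, ← mul_assoc]
      change _ = gen (.xInv i) * gen (.x i) * d i
      rw [gen_xInv_mul_x, one_mul]
      rfl
    rw [h, mul_assoc]
    exact xPow_mul_mem_range_normalForm _ (theta_mul_mem_range_normalForm i hP)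

/-- The range contains `1` and is stable under left multiplication by every generator, `∂_i` being
`x_i⁻¹ θ_i`. -/
theorem normalForm_surjective (n : ℕ) : Function.Surjective (normalForm n) := by
  have key : ∀ (a : FreeAlgebra ℂ (LaurentWeylGen n)) (P : LaurentWeyl n),
      P ∈ LinearMap.range (normalForm n) → mk n a * P ∈ LinearMap.range (normalForm n) := by
    intro a
    induction a using FreeAlgebra.induction with
    | grade0 r =>
      intro P hP
      rw [AlgHom.commutes, ← Algebra.smul_def]
      exact Submodule.smul_mem _ _ hP
    | grade1 g => exact fun P hP => gen_mul_mem_range_normalForm g hP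
    | mul a b ha hb =>
      intro P hP
      rw [map_mul, mul_assoc]
      exact ha _ (hb _ hP)
    | add a b ha hb =>
      intro P hP
      rw [map_add, add_mul]
      exact add_mem (ha _ hP) (hb _ hP)
  intro P
  obtain ⟨a, rfl⟩ : ∃ a, mk n a = P := RingQuot.mkAlgHom_surjective ℂ (LaurentWeylRel n) P
  have h := key a 1 ⟨Finsupp.single 0 1, by simp [normalForm_single, xPow_zero]⟩
  rwa [mul_one] at h

/-! ### The representation on functions on the lattice -/

/-- The images of the generators in the representation `rep`. -/
noncomputable def repGen {n : ℕ} (κ : Fin n → ℂ) :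
    LaurentWeylGen n → Module.End ℂ ((Fin n → ℤ) → ℂ)
  | .x i =>
    { toFun := fun f s => f (s - Pi.single i 1)
      map_add' := fun _ _ => rfl
      map_smul' := fun _ _ => rfl }
  | .xInv i =>
    { toFun := fun f s => f (s + Pi.single i 1)
      map_add' := fun _ _ => rfl
      map_smul' := fun _ _ => rfl }
  | .d i =>
    -- The coefficient of `x^{κ+s}` comes from differentiating `x^{κ+s+e_i}`, whose `i`-th exponent
    -- is `κ_i + s_i + 1`.
    { toFun := fun f s => (κ i + s i + 1) * f (s + Pi.single i 1)
      map_add' := fun f g => by ext s; simp only [Pi.add_apply, mul_add]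
      map_smul' := fun c f => by ext s; simp only [Pi.smul_apply, smul_eq_mul, RingHom.id_apply,
        mul_left_comm] }

theorem repGen_rel {n : ℕ} (κ : Fin n → ℂ) ⦃a b : FreeAlgebra ℂ (LaurentWeylGen n)⦄
    (h : LaurentWeylRel n a b) :
    FreeAlgebra.lift ℂ (repGen κ) a = FreeAlgebra.lift ℂ (repGen κ) b := by
  refine LinearMap.ext fun f => funext fun s => ?_
  cases h with
  | x_comm i j => simp [LaurentWeylGen.free, repGen, sub_right_comm]
  | d_comm i j =>
    by_cases hij : i = j
    · rw [hij]
    · simp [LaurentWeylGen.free, repGen, add_right_comm, hij, Ne.symm hij]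
      ring
  | d_x i j =>
    by_cases hij : i = j
    · subst hij
      simp [LaurentWeylGen.free, repGen]
      ring
    · simp [LaurentWeylGen.free, repGen, hij, add_sub_right_comm]
  | x_xInv i => simp [LaurentWeylGen.free, repGen]
  | xInv_x i => simp [LaurentWeylGen.free, repGen]

/-- The representation in which a function `f` on `ℤ^n` stands for the series
`∑_s f(s) x^{κ + s}`. -/
noncomputable def rep {n : ℕ} (κ : Fin n → ℂ) :
    LaurentWeyl n →ₐ[ℂ] Module.End ℂ ((Fin n → ℤ) → ℂ) :=
  lift (repGen κ) (repGen_rel κ)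

theorem rep_gen {n : ℕ} (κ : Fin n → ℂ) (g : LaurentWeylGen n) : rep κ (gen g) = repGen κ g :=
  lift_gen _ _ g

theorem rep_xPow {n : ℕ} (κ : Fin n → ℂ) (w : Fin n → ℤ) :
    ∀ (f : (Fin n → ℤ) → ℂ) (s : Fin n → ℤ), rep κ (xPow w) f s = f (s - w) := by
  induction w using intVec_induction with
  | zero => simp [xPow_zero]
  | add v w hv hw => simp [xPow_add, hv, hw, sub_sub]
  | single i =>
    intro f s
    rw [xPow_single, zpow_one]
    change rep κ (gen (.x i)) f s = _
    rw [rep_gen]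
    rfl
  | single_neg i =>
    intro f s
    rw [xPow_single, zpow_neg_one]
    change rep κ (gen (.xInv i)) f s = _
    rw [rep_gen, Pi.single_neg, sub_neg_eq_add]
    rfl

theorem rep_theta {n : ℕ} (κ : Fin n → ℂ) (i : Fin n) (f : (Fin n → ℤ) → ℂ) (s : Fin n → ℤ) :
    rep κ (theta i) f s = (κ i + s i) * f s := by
  change rep κ (gen (.x i) * gen (.d i)) f s = _
  rw [map_mul, rep_gen, rep_gen]
  simp only [repGen, Module.End.mul_apply, LinearMap.coe_mk, AddHom.coe_mk, sub_add_cancel,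
    Pi.sub_apply, Pi.single_eq_same, Int.cast_sub, Int.cast_one]
  ring

theorem rep_thetaPoly {n : ℕ} (κ : Fin n → ℂ) (p : MvPolynomial (Fin n) ℂ) :
    ∀ (f : (Fin n → ℤ) → ℂ) (s : Fin n → ℤ),
      rep κ (thetaPoly n p) f s = MvPolynomial.eval (fun i => κ i + s i) p * f s := by
  induction p using MvPolynomial.induction_on with
  | C c =>
    intro f s
    rw [← MvPolynomial.algebraMap_eq, AlgHom.commutes, AlgHom.commutes]
    simp [Module.algebraMap_end_apply]
  | add p q hp hq =>
    intro f s
    simp [hp, hq, add_mul]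
  | mul_X p i hp =>
    intro f s
    simp [hp, thetaPoly_X, rep_theta, mul_assoc]

theorem rep_normalForm {n : ℕ} (κ : Fin n → ℂ) (F : (Fin n → ℤ) →₀ MvPolynomial (Fin n) ℂ)
    (f : (Fin n → ℤ) → ℂ) (s : Fin n → ℤ) :
    rep κ (normalForm n F) f s
      = F.sum fun w p => MvPolynomial.eval (fun i => κ i + (s - w) i) p * f (s - w) := by
  simp [normalForm_apply, Finsupp.sum, map_sum, rep_xPow, rep_thetaPoly]

/-- The shifted lattice is a product of the infinite sets `κ_i + ℤ`, and such a product is Zariski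
dense. -/
theorem eq_zero_of_eval_lattice {n : ℕ} (κ : Fin n → ℂ) {p : MvPolynomial (Fin n) ℂ}
    (h : ∀ s : Fin n → ℤ, MvPolynomial.eval (fun i => κ i + s i) p = 0) : p = 0 := by
  refine MvPolynomial.funext_set (fun i => Set.range fun k : ℤ => κ i + k) (fun i => ?_) ?_
  · exact Set.infinite_range_of_injective fun a b hab => by simpa using hab
  · intro y hy
    choose s hs using fun i => hy i trivial
    rw [map_zero, ← h s]
    exact congrArg (fun z => MvPolynomial.eval z p) (funext fun i => (hs i).symm)

theorem eq_zero_of_rep_normalForm_eq_zero {n : ℕ} (κ : Fin n → ℂ)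
    {F : (Fin n → ℤ) →₀ MvPolynomial (Fin n) ℂ} (h : rep κ (normalForm n F) = 0) : F = 0 := by
  classical
  ext1 w
  refine eq_zero_of_eval_lattice κ fun t => ?_
  -- Applied to the delta function at `t` and read off at `t + w`, only the `w`-term survives, with
  -- value `p_w(κ + t)`.
  have h1 := congrFun (LinearMap.congr_fun h (Pi.single t 1)) (t + w)
  rw [rep_normalForm, Finsupp.sum, Finset.sum_eq_single w] at h1
  · simpa using h1
  · intro v _ hv
    have : t + w - v ≠ t := fun e => hv <| by
      rw [add_sub_assoc, add_eq_left, sub_eq_zero] at e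
      exact e.symm
    rw [Pi.single_eq_of_ne this, mul_zero]
  · intro hw
    simp [Finsupp.notMem_support_iff.1 hw]

theorem normalForm_injective (n : ℕ) : Function.Injective (normalForm n) :=
  (injective_iff_map_eq_zero _).2 fun F hF =>
    eq_zero_of_rep_normalForm_eq_zero 0 (by rw [hF, map_zero])

theorem rep_injective {n : ℕ} (κ : Fin n → ℂ) : Function.Injective (rep κ) :=
  (injective_iff_map_eq_zero _).2 fun P hP => by
    obtain ⟨F, rfl⟩ := normalForm_surjective n P
    rw [eq_zero_of_rep_normalForm_eq_zero κ hP, map_zero]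

/-! ### The splitting of the lattice -/

/-- The columns of `A` span, so `A` has a right inverse `C`; the columns of `1 - CA` lie in `ker A`,
the image of `B`, which yields `D`. Independence of the columns of `B` is not assumed: `DB = 1`
comes from the count `n = d + m`. -/
theorem exists_splitting {n m d : ℕ} (h : n = d + m) {A : Matrix (Fin d) (Fin n) ℤ}
    (hA : Submodule.span ℤ (Set.range A.col) = ⊤) {B : Matrix (Fin n) (Fin m) ℤ}
    (hB : Submodule.span ℤ (Set.range B.col) = LinearMap.ker A.mulVecLin) :
    ∃ (C : Matrix (Fin n) (Fin d) ℤ) (D : Matrix (Fin m) (Fin n) ℤ),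
      C * A + B * D = 1 ∧ D * B = 1 := by
  rw [← Matrix.range_mulVecLin] at hA hB
  have hC : ∀ k, ∃ c, A.mulVecLin c = Pi.single k 1 := fun k =>
    LinearMap.range_eq_top.1 hA _
  choose c hc using hC
  have hAC : A * (Matrix.of c).transpose = 1 := by
    ext i k
    rw [Matrix.one_apply, ← Pi.single_apply, ← hc k]
    rfl
  have hD : ∀ i, ∃ v, B.mulVecLin v = (1 - (Matrix.of c).transpose * A).col i := by
    intro i
    rw [← LinearMap.mem_range, hB, LinearMap.mem_ker, Matrix.mulVecLin_apply,
      ← Matrix.mulVec_single_one, Matrix.mulVec_mulVec, Matrix.mul_sub, ← Matrix.mul_assoc,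
      hAC, Matrix.mul_one, Matrix.one_mul, sub_self, Matrix.zero_mulVec]
  choose v hv using hD
  have hBD : B * (Matrix.of v).transpose = 1 - (Matrix.of c).transpose * A := by
    ext i j
    exact congrFun (hv j) i
  refine ⟨(Matrix.of c).transpose, (Matrix.of v).transpose, by rw [hBD]; abel, ?_⟩
  -- The block matrices `[C B]` and `[A; D]` are square, so a one-sided inverse is two-sided; the
  -- lower right block of the reversed product is `DB`.
  have h1 : Matrix.fromCols (Matrix.of c).transpose B
      * Matrix.fromRows A (Matrix.of v).transpose = 1 := by
    rw [Matrix.fromCols_mul_fromRows, hBD]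
    abel
  rw [Matrix.fromCols_mul_fromRows_eq_one_comm (finCongr h |>.trans finSumFinEquiv.symm),
    Matrix.fromRows_mul_fromCols,
    ← Matrix.fromBlocks_one, Matrix.fromBlocks_inj] at h1
  exact h1.2.2.2

/-! ### The affine substitution `s = κ + B η` -/

/-- The substitution of the affine forms `B_i · η + κ_i` into polynomials. -/
noncomputable def affineSubst {n m : ℕ} (B : Matrix (Fin n) (Fin m) ℤ) (κ : Fin n → ℂ) :
    MvPolynomial (Fin n) ℂ →ₐ[ℂ] MvPolynomial (Fin m) ℂ :=
  MvPolynomial.aeval fun i =>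
    (B.map (Int.cast : ℤ → MvPolynomial (Fin m) ℂ)).mulVec MvPolynomial.X i + MvPolynomial.C (κ i)

/-- The substitution of the linear forms in `s - κ` given by the rows of `D`. -/
noncomputable def centeredSubst {n m : ℕ} (D : Matrix (Fin m) (Fin n) ℤ) (κ : Fin n → ℂ) :
    MvPolynomial (Fin m) ℂ →ₐ[ℂ] MvPolynomial (Fin n) ℂ :=
  MvPolynomial.aeval
    ((D.map (Int.cast : ℤ → MvPolynomial (Fin n) ℂ)).mulVec
      fun i => MvPolynomial.X i - MvPolynomial.C (κ i))

theorem map_intCast_mulVec {R S : Type*} [CommRing R] [CommRing S] (φ : R →+* S) {k l : ℕ}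
    (M : Matrix (Fin k) (Fin l) ℤ) (y : Fin l → R) (i : Fin k) :
    φ ((M.map (Int.cast : ℤ → R)).mulVec y i)
      = (M.map (Int.cast : ℤ → S)).mulVec (fun j => φ (y j)) i := by
  simp [Matrix.mulVec, dotProduct]

theorem intCast_mulVec_mulVec {R : Type*} [CommRing R] {k l r : ℕ} (M : Matrix (Fin k) (Fin l) ℤ)
    (N : Matrix (Fin l) (Fin r) ℤ) (y : Fin r → R) :
    (M.map (Int.cast : ℤ → R)).mulVec ((N.map (Int.cast : ℤ → R)).mulVec y)
      = ((M * N).map (Int.cast : ℤ → R)).mulVec y := by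
  rw [Matrix.mulVec_mulVec]
  congr 1
  exact (Matrix.map_mul (f := Int.castRingHom R)).symm

theorem intCast_one_mulVec {R : Type*} [CommRing R] {k : ℕ} (y : Fin k → R) :
    ((1 : Matrix (Fin k) (Fin k) ℤ).map (Int.cast : ℤ → R)).mulVec y = y := by
  rw [Matrix.map_one _ Int.cast_zero Int.cast_one, Matrix.one_mulVec]

theorem affineSubst_X_sub_C {n m : ℕ} (B : Matrix (Fin n) (Fin m) ℤ) (κ : Fin n → ℂ) (i : Fin n) :
    affineSubst B κ (MvPolynomial.X i - MvPolynomial.C (κ i))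
      = (B.map (Int.cast : ℤ → MvPolynomial (Fin m) ℂ)).mulVec MvPolynomial.X i := by
  rw [map_sub, affineSubst, MvPolynomial.aeval_X, MvPolynomial.aeval_C,
    MvPolynomial.algebraMap_eq, add_sub_cancel_right]

/-- In the centered coordinates `s - κ` the two substitutions are the linear maps `B` and `D`, so
`DB = 1` suffices. The section obtained here gives surjectivity of `δ`. -/
theorem affineSubst_centeredSubst {n m : ℕ} {B : Matrix (Fin n) (Fin m) ℤ}
    {D : Matrix (Fin m) (Fin n) ℤ} (h : D * B = 1) (κ : Fin n → ℂ) (q : MvPolynomial (Fin m) ℂ) :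
    affineSubst B κ (centeredSubst D κ q) = q := by
  have key : (affineSubst B κ).comp (centeredSubst D κ) = AlgHom.id ℂ _ := by
    refine MvPolynomial.algHom_ext fun j => ?_
    rw [AlgHom.comp_apply, centeredSubst, MvPolynomial.aeval_X]
    refine (map_intCast_mulVec (affineSubst B κ).toRingHom D _ j).trans ?_
    have : (fun i => (affineSubst B κ).toRingHom (MvPolynomial.X i - MvPolynomial.C (κ i)))
        = (B.map (Int.cast : ℤ → MvPolynomial (Fin m) ℂ)).mulVec MvPolynomial.X :=
      funext fun i => affineSubst_X_sub_C B κ i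
    rw [this, intCast_mulVec_mulVec, h, intCast_one_mulVec]
    rfl
  exact DFunLike.congr_fun key q

/-- The affine form `a_k · (s - κ)`, where `a_k` is the `k`-th row of `A`. -/
noncomputable def eulerPoly {d n : ℕ} (A : Matrix (Fin d) (Fin n) ℤ) (κ : Fin n → ℂ) :
    Fin d → MvPolynomial (Fin n) ℂ :=
  (A.map (Int.cast : ℤ → MvPolynomial (Fin n) ℂ)).mulVec
    fun i => MvPolynomial.X i - MvPolynomial.C (κ i)

theorem affineSubst_eulerPoly {d n m : ℕ} {A : Matrix (Fin d) (Fin n) ℤ}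
    {B : Matrix (Fin n) (Fin m) ℤ} (h : A * B = 0) (κ : Fin n → ℂ) (k : Fin d) :
    affineSubst B κ (eulerPoly A κ k) = 0 := by
  refine (map_intCast_mulVec (affineSubst B κ).toRingHom A _ k).trans ?_
  have : (fun i => (affineSubst B κ).toRingHom (MvPolynomial.X i - MvPolynomial.C (κ i)))
      = (B.map (Int.cast : ℤ → MvPolynomial (Fin m) ℂ)).mulVec MvPolynomial.X :=
    funext fun i => affineSubst_X_sub_C B κ i
  rw [this, intCast_mulVec_mulVec, h]
  simp

/-- From `s - κ = C(A(s - κ)) + B(D(s - κ))`, the composite of `affineSubst` and `centeredSubst` is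
the identity modulo the forms `a_k · (s - κ)`. So `p` is congruent to the image of `affineSubst B κ
p = 0`. -/
theorem mem_span_eulerPoly {d n m : ℕ} {A : Matrix (Fin d) (Fin n) ℤ}
    {B : Matrix (Fin n) (Fin m) ℤ} {C : Matrix (Fin n) (Fin d) ℤ} {D : Matrix (Fin m) (Fin n) ℤ}
    (h : C * A + B * D = 1) (κ : Fin n → ℂ) {p : MvPolynomial (Fin n) ℂ}
    (hp : affineSubst B κ p = 0) : p ∈ Ideal.span (Set.range (eulerPoly A κ)) := by
  set I := Ideal.span (Set.range (eulerPoly A κ))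
  have key : (Ideal.Quotient.mkₐ ℂ I).comp ((centeredSubst D κ).comp (affineSubst B κ))
      = Ideal.Quotient.mkₐ ℂ I := by
    refine MvPolynomial.algHom_ext fun i => ?_
    set y : Fin n → MvPolynomial (Fin n) ℂ := fun i => MvPolynomial.X i - MvPolynomial.C (κ i)
      with hy
    have h1 : y i = (C.map (Int.cast : ℤ → MvPolynomial (Fin n) ℂ)).mulVec (eulerPoly A κ) i
        + (B.map (Int.cast : ℤ → MvPolynomial (Fin n) ℂ)).mulVec
          ((D.map (Int.cast : ℤ → MvPolynomial (Fin n) ℂ)).mulVec y) i := by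
      rw [eulerPoly, ← hy, intCast_mulVec_mulVec, intCast_mulVec_mulVec, ← Pi.add_apply,
        ← Matrix.add_mulVec, ← Matrix.map_add _ Int.cast_add, h, intCast_one_mulVec]
    have h2 : centeredSubst D κ (affineSubst B κ (MvPolynomial.X i))
        = (B.map (Int.cast : ℤ → MvPolynomial (Fin n) ℂ)).mulVec
          ((D.map (Int.cast : ℤ → MvPolynomial (Fin n) ℂ)).mulVec y) i + MvPolynomial.C (κ i) := by
      rw [affineSubst, MvPolynomial.aeval_X, map_add]
      congr 1
      · refine (map_intCast_mulVec (centeredSubst D κ).toRingHom B _ i).trans ?_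
        congr 1
        funext j
        exact MvPolynomial.aeval_X _ _
      · exact (centeredSubst D κ).commutes (κ i)
    rw [AlgHom.comp_apply, AlgHom.comp_apply, h2, eq_comm, Ideal.Quotient.mkₐ_eq_mk,
      Ideal.Quotient.eq]
    have h3 : MvPolynomial.X i - ((B.map (Int.cast : ℤ → MvPolynomial (Fin n) ℂ)).mulVec
          ((D.map (Int.cast : ℤ → MvPolynomial (Fin n) ℂ)).mulVec y) i + MvPolynomial.C (κ i))
        = (C.map (Int.cast : ℤ → MvPolynomial (Fin n) ℂ)).mulVec (eulerPoly A κ) i := by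
      linear_combination h1
    rw [h3]
    rw [Matrix.mulVec, dotProduct]
    exact sum_mem fun k _ => I.mul_mem_left _ (Ideal.subset_span ⟨k, rfl⟩)
  have h4 := DFunLike.congr_fun key p
  rw [AlgHom.comp_apply, AlgHom.comp_apply, hp, map_zero, map_zero, eq_comm] at h4
  exact Ideal.Quotient.eq_zero_iff_mem.1 h4

theorem eval_affineSubst {n m : ℕ} (B : Matrix (Fin n) (Fin m) ℤ) (κ : Fin n → ℂ)
    (p : MvPolynomial (Fin n) ℂ) (v : Fin m → ℤ) :
    MvPolynomial.eval (fun j => (v j : ℂ)) (affineSubst B κ p)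
      = MvPolynomial.eval (fun i => κ i + B.mulVec v i) p := by
  have key : (MvPolynomial.aeval (fun j => (v j : ℂ))).comp (affineSubst B κ)
      = MvPolynomial.aeval (fun i => κ i + B.mulVec v i) := by
    refine MvPolynomial.algHom_ext fun i => ?_
    simp [affineSubst, Matrix.mulVec, dotProduct, add_comm]
  exact DFunLike.congr_fun key p

/-! ### Invariant operators -/

theorem scale_xPow_mul_thetaPoly {n : ℕ} (c : Fin n → ℂˣ) (w : Fin n → ℤ)
    (p : MvPolynomial (Fin n) ℂ) :
    scale c (xPow w * thetaPoly n p)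
      = xPow w * thetaPoly n (((∏ i, c i ^ w i : ℂˣ) : ℂ) • p) := by
  rw [map_mul, scale_xPow, scale_thetaPoly, map_smul, smul_mul_assoc, mul_smul_comm]

/-- Rescaling acts diagonally on normal forms, so uniqueness of normal forms permits a comparison
term by term. -/
theorem coeff_eq_of_scale_normalForm_eq {n : ℕ} (c : Fin n → ℂˣ)
    {F : (Fin n → ℤ) →₀ MvPolynomial (Fin n) ℂ} (h : scale c (normalForm n F) = normalForm n F)
    (w : Fin n → ℤ) : ((∏ i, c i ^ w i : ℂˣ) : ℂ) • F w = F w := by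
  classical
  let T : ((Fin n → ℤ) →₀ MvPolynomial (Fin n) ℂ) →ₗ[ℂ] (Fin n → ℤ) →₀ MvPolynomial (Fin n) ℂ :=
    Finsupp.lsum ℂ fun w => ((∏ i, c i ^ w i : ℂˣ) : ℂ) • Finsupp.lsingle w
  have hT : ∀ w p, T (Finsupp.single w p)
      = Finsupp.single w (((∏ i, c i ^ w i : ℂˣ) : ℂ) • p) := fun w p => by simp [T]
  have h1 : (scale c).toLinearMap ∘ₗ normalForm n = normalForm n ∘ₗ T := by
    refine Finsupp.lhom_ext fun w p => ?_
    simp only [LinearMap.comp_apply, AlgHom.toLinearMap_apply]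
    rw [hT, normalForm_single, normalForm_single, scale_xPow_mul_thetaPoly]
  have h2 : ∀ G w, T G w = ((∏ i, c i ^ w i : ℂˣ) : ℂ) • G w := by
    intro G w
    induction G using Finsupp.induction_linear with
    | zero => simp
    | add f g hf hg => rw [map_add, Finsupp.add_apply, hf, hg, Finsupp.add_apply, smul_add]
    | single v p =>
      rw [hT, Finsupp.single_apply, Finsupp.single_apply]
      split_ifs with hvw
      · rw [hvw]
      · rw [smul_zero]
  have h3 : T F = F := normalForm_injective n ((LinearMap.congr_fun h1 F).symm.trans h)
  rw [← h2, h3]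

theorem exists_prod_character_ne_one {d n : ℕ} {A : Matrix (Fin d) (Fin n) ℤ} {w : Fin n → ℤ}
    (h : A.mulVec w ≠ 0) : ∃ t : Fin d → ℂˣ, ∏ i, character t (A.col i) ^ w i ≠ 1 := by
  obtain ⟨k, hk⟩ := Function.ne_iff.1 h
  -- With `2` in slot `k` and `1` elsewhere, the product is `2^{(Aw)_k}`; as `2` is not a root of
  -- unity, it is not `1`.
  let c : ℂˣ := Units.mk0 2 two_ne_zero
  have hsum : ∀ (a : Fin n → ℤ), ∏ i, c ^ a i = c ^ ∑ i, a i := fun a => by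
    have := map_sum (zpowersHom ℂˣ c).toAdditiveRight a Finset.univ
    exact this.symm
  refine ⟨Pi.mulSingle k c, fun h1 => hk ?_⟩
  have h2 : ∀ i, character (Pi.mulSingle k c) (A.col i) = c ^ A k i := by
    intro i
    rw [character, Finset.prod_eq_single k]
    · simp
    · intro j _ hj
      simp [hj]
    · simp
  simp only [h2, ← zpow_mul] at h1
  rw [hsum] at h1
  have h3 := congrArg (fun z : ℂˣ => ‖(z : ℂ)‖) h1
  simp only [Units.val_zpow_eq_zpow_val, norm_zpow, Units.val_one, norm_one, c, Units.val_mk0,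
    Complex.norm_ofNat] at h3
  exact (zpow_eq_one_iff_right₀ (by norm_num) (by norm_num)).1 h3

theorem thetaPoly_mem_invariants {d n : ℕ} (A : Matrix (Fin d) (Fin n) ℤ)
    (p : MvPolynomial (Fin n) ℂ) : thetaPoly n p ∈ invariants A := fun _ => scale_thetaPoly _ p

/-- The substitution of `θ_1, …, θ_n` into polynomials, with invariant values. -/
noncomputable def invThetaPoly {d n : ℕ} (A : Matrix (Fin d) (Fin n) ℤ) :
    MvPolynomial (Fin n) ℂ →ₐ[ℂ] invariants A :=
  (thetaPoly n).codRestrict (invariants A) (thetaPoly_mem_invariants A)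

/-- The constant term of `a_k · (s - κ)` is `-(Aκ)_k`; this is where `Aκ = β` enters. -/
theorem invThetaPoly_eulerPoly {d n : ℕ} (A : Matrix (Fin d) (Fin n) ℤ) {κ : Fin n → ℂ}
    {β : Fin d → ℂ} (hκ : (A.map (Int.cast : ℤ → ℂ)).mulVec κ = β) (k : Fin d) :
    invThetaPoly A (eulerPoly A κ k) = euler A k - algebraMap ℂ (invariants A) (β k) := by
  have hX : ∀ j, invThetaPoly A (MvPolynomial.X j) = ⟨theta j, theta_mem_invariants A j⟩ :=
    fun j => Subtype.ext (thetaPoly_X j)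
  have hC : ∀ c, invThetaPoly A (MvPolynomial.C c) = algebraMap ℂ (invariants A) c :=
    (invThetaPoly A).commutes
  subst hκ
  simp only [eulerPoly, euler, Matrix.mulVec, dotProduct, hX, hC, mul_sub, zsmul_eq_mul, map_sum,
    map_sub, map_mul, map_intCast, Matrix.map_apply, Finset.sum_sub_distrib]

/-- The operator `∑_v x^{Bv} p_v(θ)`. -/
noncomputable def invForm {d n m : ℕ} {A : Matrix (Fin d) (Fin n) ℤ} {B : Matrix (Fin n) (Fin m) ℤ}
    (hB : Submodule.span ℤ (Set.range B.col) = LinearMap.ker A.mulVecLin) :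
    ((Fin m → ℤ) →₀ MvPolynomial (Fin n) ℂ) →ₗ[ℂ] invariants A :=
  Finsupp.lsum ℂ fun v =>
    LinearMap.mulLeft ℂ (⟨xPow (B.mulVec v), xPow_mem_invariants A _ (mulVec_mulVec_eq_zero hB v)⟩ :
      invariants A) ∘ₗ (invThetaPoly A).toLinearMap

section

variable {d n m : ℕ} {A : Matrix (Fin d) (Fin n) ℤ} {B : Matrix (Fin n) (Fin m) ℤ}
  (hB : Submodule.span ℤ (Set.range B.col) = LinearMap.ker A.mulVecLin)

theorem invForm_single (v : Fin m → ℤ) (p : MvPolynomial (Fin n) ℂ) :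
    invForm hB (Finsupp.single v p)
      = ⟨xPow (B.mulVec v), xPow_mem_invariants A _ (mulVec_mulVec_eq_zero hB v)⟩
        * invThetaPoly A p := by
  simp [invForm]

theorem coe_invForm_single (v : Fin m → ℤ) (p : MvPolynomial (Fin n) ℂ) :
    (invForm hB (Finsupp.single v p) : LaurentWeyl n)
      = xPow (B.mulVec v) * thetaPoly n p := by
  rw [invForm_single]
  rfl

/-- If `Aw ≠ 0`, some `t` scales the `w`-term by a factor other than `1`, so that term vanishes. The
remaining exponents lie in `ker A` and have the form `Bv`. -/
theorem invForm_surjective : Function.Surjective (invForm hB) := by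
  intro P
  obtain ⟨G, hG⟩ := normalForm_surjective n (P : LaurentWeyl n)
  have hinv : ∀ t : Fin d → ℂˣ,
      scale (fun i => character t (A.col i)) (normalForm n G) = normalForm n G := by
    rw [hG]
    exact P.2
  have hP : (P : LaurentWeyl n)
      ∈ (LinearMap.range (invForm hB)).map (invariants A).val.toLinearMap := by
    rw [← hG, normalForm_apply]
    refine sum_mem fun w hw => ?_
    have hw0 : w ∈ LinearMap.ker A.mulVecLin := by
      by_contra hAw
      obtain ⟨t, ht⟩ := exists_prod_character_ne_one hAw
      have h1 := coeff_eq_of_scale_normalForm_eq _ (hinv t) w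
      rw [← sub_eq_zero] at h1
      nth_rewrite 2 [← one_smul ℂ (G w)] at h1
      rw [← sub_smul, smul_eq_zero, sub_eq_zero] at h1
      refine h1.elim (fun h => ht (Units.ext h)) (Finsupp.mem_support_iff.1 hw)
    rw [← hB, ← Matrix.range_mulVecLin] at hw0
    obtain ⟨v, rfl⟩ := hw0
    exact ⟨_, ⟨Finsupp.single v (G (B.mulVec v)), rfl⟩, coe_invForm_single hB v _⟩
  obtain ⟨Q, ⟨F, rfl⟩, hQ⟩ := hP
  exact ⟨F, Subtype.ext hQ⟩

theorem invForm_single_prod_X_pow (v : Fin m → ℤ) (u : Fin n → ℕ) :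
    invForm hB (Finsupp.single v (∏ i, MvPolynomial.X i ^ u i))
      = invMonomial A (B.mulVec v) (mulVec_mulVec_eq_zero hB v) u :=
  Subtype.ext (by rw [coe_invForm_single, thetaPoly_prod_X_pow]; rfl)

theorem span_invMonomial :
    Submodule.span ℂ (Set.range fun p : (Fin m → ℤ) × (Fin n → ℕ) =>
      invMonomial A (B.mulVec p.1) (mulVec_mulVec_eq_zero hB p.1) p.2) = ⊤ := by
  refine eq_top_iff.2 fun P _ => ?_
  obtain ⟨F, rfl⟩ := invForm_surjective hB P
  induction F using Finsupp.induction_linear with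
  | zero => rw [map_zero]; exact zero_mem _
  | add f g hf hg => rw [map_add]; exact add_mem (hf trivial) (hg trivial)
  | single v p =>
    induction p using MvPolynomial.induction_on' with
    | monomial u c =>
      have h : MvPolynomial.monomial u c = c • ∏ i, MvPolynomial.X i ^ u i := by
        rw [MvPolynomial.monomial_eq, Finsupp.prod_fintype _ _ (fun _ => pow_zero _),
          MvPolynomial.smul_eq_C_mul]
      rw [h, ← Finsupp.smul_single, map_smul, invForm_single_prod_X_pow]
      exact Submodule.smul_mem _ _ (Submodule.subset_span ⟨(v, u), rfl⟩)
    | add p q hp hq => rw [Finsupp.single_add, map_add]; exact add_mem (hp trivial) (hq trivial)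

end

/-! ### Restriction of the representation to a coset of the lattice -/

/-- The operators `P` and `Q` agree along `v ↦ κ + Bv`. -/
def Intertwines {n m : ℕ} (B : Matrix (Fin n) (Fin m) ℤ) (κ : Fin n → ℂ) (P : LaurentWeyl n)
    (Q : LaurentWeyl m) : Prop :=
  ∀ f : (Fin n → ℤ) → ℂ, rep κ P f ∘ B.mulVec = rep 0 Q (f ∘ B.mulVec)

namespace Intertwines

variable {n m : ℕ} {B : Matrix (Fin n) (Fin m) ℤ} {κ : Fin n → ℂ} {P P' : LaurentWeyl n}
  {Q Q' : LaurentWeyl m}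

theorem add (h : Intertwines B κ P Q) (h' : Intertwines B κ P' Q') :
    Intertwines B κ (P + P') (Q + Q') := fun f => by
  rw [map_add, map_add, LinearMap.add_apply, LinearMap.add_apply, ← h f, ← h' f]
  rfl

theorem mul (h : Intertwines B κ P Q) (h' : Intertwines B κ P' Q') :
    Intertwines B κ (P * P') (Q * Q') := fun f => by
  rw [map_mul, map_mul, Module.End.mul_apply, Module.End.mul_apply, h, h']

theorem algebraMap (c : ℂ) :
    Intertwines B κ (algebraMap ℂ (LaurentWeyl n) c) (algebraMap ℂ (LaurentWeyl m) c) := fun f => by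
  rw [AlgHom.commutes, AlgHom.commutes]
  rfl

/-- Along `s ↦ Bs`, a shift by `Bv` is a shift by `v`, and the multiplier `p(κ + Bs)` is the value
of `affineSubst B κ p` at `s`. -/
theorem xPow_mul_thetaPoly (v : Fin m → ℤ) (p : MvPolynomial (Fin n) ℂ) :
    Intertwines B κ (xPow (B.mulVec v) * thetaPoly n p)
      (xPow v * thetaPoly m (affineSubst B κ p)) := fun f => funext fun s => by
  simp only [Function.comp_apply, map_mul, Module.End.mul_apply, rep_xPow, rep_thetaPoly,
    Pi.zero_apply, zero_add, eval_affineSubst, Matrix.mulVec_sub]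

/-- Every function `g` on `ℤ^m` is the restriction of `g ∘ D`, because `DB = 1`; so `P` determines
the action of `Q`, which is faithful. -/
theorem unique {D : Matrix (Fin m) (Fin n) ℤ} (hDB : D * B = 1) (h : Intertwines B κ P Q)
    (h' : Intertwines B κ P Q') : Q = Q' := by
  refine rep_injective 0 (LinearMap.ext fun g => ?_)
  have hg : (g ∘ D.mulVec) ∘ B.mulVec = g := funext fun v => by
    simp [Matrix.mulVec_mulVec, hDB]
  rw [← hg, ← h, ← h']

end Intertwines

section

variable {d n m : ℕ} {A : Matrix (Fin d) (Fin n) ℤ} {B : Matrix (Fin n) (Fin m) ℤ} (κ : Fin n → ℂ)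

theorem intertwines_invForm
    (hB : Submodule.span ℤ (Set.range B.col) = LinearMap.ker A.mulVecLin)
    (F : (Fin m → ℤ) →₀ MvPolynomial (Fin n) ℂ) :
    Intertwines B κ (invForm hB F)
      (normalForm m (Finsupp.mapRange.linearMap (affineSubst B κ).toLinearMap F)) := by
  induction F using Finsupp.induction_linear with
  | zero => simpa using Intertwines.algebraMap (B := B) (κ := κ) 0
  | add f g hf hg =>
    rw [map_add, map_add, map_add]
    exact hf.add hg
  | single v p =>
    rw [Finsupp.mapRange.linearMap_apply, Finsupp.mapRange_single, normalForm_single,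
      coe_invForm_single]
    exact Intertwines.xPow_mul_thetaPoly v p

/-- Partners are chosen arbitrarily; since sums and products of partners are partners, uniqueness
forces the choice to be an algebra homomorphism. -/
theorem exists_algHom_intertwines
    (hB : Submodule.span ℤ (Set.range B.col) = LinearMap.ker A.mulVecLin)
    {D : Matrix (Fin m) (Fin n) ℤ} (hDB : D * B = 1) :
    ∃ δ : invariants A →ₐ[ℂ] LaurentWeyl m,
      ∀ P : invariants A, Intertwines B κ (P : LaurentWeyl n) (δ P) := by
  have hex : ∀ P : invariants A, ∃ Q, Intertwines B κ (P : LaurentWeyl n) Q := fun P => by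
    obtain ⟨F, rfl⟩ := invForm_surjective hB P
    exact ⟨_, intertwines_invForm κ hB F⟩
  choose δ hδ using hex
  have hc : ∀ c : ℂ, δ (algebraMap ℂ (invariants A) c) = algebraMap ℂ (LaurentWeyl m) c :=
    fun c => (hδ _).unique hDB (Intertwines.algebraMap c)
  exact ⟨{ toFun := δ
           map_one' := by simpa using hc 1
           map_mul' := fun P Q => (hδ _).unique hDB ((hδ P).mul (hδ Q))
           map_zero' := by simpa using hc 0
           map_add' := fun P Q => (hδ _).unique hDB ((hδ P).add (hδ Q))
           commutes' := hc }, hδ⟩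

theorem xPow_mul_thetaPoly_affineSubst_prod (v : Fin m → ℤ) (u : Fin n → ℕ) :
    xPow v * thetaPoly m (affineSubst B κ (∏ i, MvPolynomial.X i ^ u i)) = hornMonomial B κ v u := by
  have hi : ∀ i, thetaPoly m (affineSubst B κ (MvPolynomial.X i))
      = (∑ j, B i j • (theta j : LaurentWeyl m)) + algebraMap ℂ (LaurentWeyl m) (κ i) := by
    intro i
    rw [affineSubst, MvPolynomial.aeval_X, map_add, ← MvPolynomial.algebraMap_eq, AlgHom.commutes]
    simp [Matrix.mulVec, dotProduct, thetaPoly_X, zsmul_eq_mul]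
  simp only [map_prod, map_pow]
  rw [thetaPoly_prod_pow]
  simp only [hi]
  rfl

end

end LaurentWeyl

/-! ### The homomorphism, its surjectivity and its kernel -/

open LaurentWeyl in
theorem proposition5 (n m d : ℕ) (hm : 0 < m) (hmn : m < n) (hd : d = n - m)
    (A : Matrix (Fin d) (Fin n) ℤ)
    (hAspan : Submodule.span ℤ (Set.range A.col) = ⊤)
    (hApointed : ∃ h : Fin d → ℝ, ∀ i : Fin n, 0 < ∑ k, h k * (A k i : ℝ))
    (B : Matrix (Fin n) (Fin m) ℤ)
    (hB : Submodule.span ℤ (Set.range B.col) = LinearMap.ker A.mulVecLin)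
    (β : Fin d → ℂ) (κ : Fin n → ℂ)
    (hκ : (A.map (Int.cast : ℤ → ℂ)).mulVec κ = β) :
    Submodule.span ℂ (Set.range fun p : (Fin m → ℤ) × (Fin n → ℕ) =>
        invMonomial A (B.mulVec p.1) (mulVec_mulVec_eq_zero hB p.1) p.2) = ⊤ ∧
      ∃ δ : invariants A →ₐ[ℂ] LaurentWeyl m,
        (∀ (v : Fin m → ℤ) (u : Fin n → ℕ),
          δ (invMonomial A (B.mulVec v) (mulVec_mulVec_eq_zero hB v) u) = hornMonomial B κ v u) ∧
        Function.Surjective δ ∧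
        TwoSidedIdeal.ker δ =
          TwoSidedIdeal.span (Set.range fun k : Fin d =>
            euler A k - algebraMap ℂ (invariants A) (β k)) := by
  obtain ⟨C, D, hCD, hDB⟩ := exists_splitting (by omega) hAspan hB
  obtain ⟨δ, hδ⟩ := exists_algHom_intertwines κ hB hDB
  have hform : ∀ F, δ (invForm hB F)
      = normalForm m (Finsupp.mapRange.linearMap (affineSubst B κ).toLinearMap F) :=
    fun F => (hδ _).unique hDB (intertwines_invForm κ hB F)
  have hsingle : ∀ v p, δ (invForm hB (Finsupp.single v p))
      = xPow v * thetaPoly m (affineSubst B κ p) := fun v p => by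
    rw [hform, Finsupp.mapRange.linearMap_apply, Finsupp.mapRange_single, normalForm_single]
    rfl
  refine ⟨span_invMonomial hB, δ, fun v u => ?_, fun Q => ?_, le_antisymm ?_ ?_⟩
  · rw [← invForm_single_prod_X_pow hB, hsingle, xPow_mul_thetaPoly_affineSubst_prod]
  · obtain ⟨G, rfl⟩ := normalForm_surjective m Q
    refine ⟨invForm hB (Finsupp.mapRange.linearMap (centeredSubst D κ).toLinearMap G), ?_⟩
    rw [hform]
    congr 1
    ext1 v
    exact affineSubst_centeredSubst hDB κ (G v)
  · intro P hP
    rw [TwoSidedIdeal.mem_ker] at hP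
    obtain ⟨F, rfl⟩ := invForm_surjective hB P
    rw [hform] at hP
    -- Uniqueness of normal forms in the `z` variables makes every substituted coefficient vanish
    -- separately.
    have hF := (injective_iff_map_eq_zero _).1 (normalForm_injective m) _ hP
    set J := TwoSidedIdeal.span (Set.range fun k : Fin d =>
      euler A k - algebraMap ℂ (invariants A) (β k)) with hJ
    -- The preimage of `J` in the commutative polynomial ring is an ideal, so only the generators
    -- need checking.
    have hle : Ideal.span (Set.range (eulerPoly A κ)) ≤ J.asIdeal.comap (invThetaPoly A) := by
      rw [Ideal.span_le]
      rintro _ ⟨k, rfl⟩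
      change invThetaPoly A (eulerPoly A κ k) ∈ J
      rw [invThetaPoly_eulerPoly A hκ]
      exact TwoSidedIdeal.subset_span ⟨k, rfl⟩
    have hmem : ∀ v, invThetaPoly A (F v) ∈ J := fun v =>
      hle (mem_span_eulerPoly hCD κ (DFunLike.congr_fun hF v))
    change invForm hB F ∈ J.asIdeal
    rw [invForm, Finsupp.lsum_apply]
    exact sum_mem fun v _ => J.mul_mem_left _ _ (hmem v)
  · rw [TwoSidedIdeal.span_le]
    rintro _ ⟨k, rfl⟩
    rw [SetLike.mem_coe, TwoSidedIdeal.mem_ker]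
    have hAB : A * B = 0 := by
      ext i j
      have h := congrFun (mulVec_mulVec_eq_zero hB (Pi.single j 1)) i
      rw [Matrix.mulVec_mulVec, Matrix.mulVec_single_one] at h
      exact h
    -- The exponent `v = 0` makes the monomial factor trivial, leaving `E_k - β_k` itself.
    have h1 := hsingle 0 (eulerPoly A κ k)
    rw [affineSubst_eulerPoly hAB, map_zero, mul_zero, invForm_single,
      invThetaPoly_eulerPoly A hκ] at h1
    rw [← h1]
    congr 1
    refine Subtype.ext ?_
    simp [xPow_zero]
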